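/- Let $[1,\alpha]$ denote an ordinal interval with its order topology, and put \[ H_1=\{f\in C([1,\omega\cdot 2],\mathbb R): f(\omega\cdot 2)=0\},\qquad H_2=C([1,\omega],\mathbb R), \] with the supremum norms. Definitions. All Banach spaces are real and nonzero. Let $K$ be a compact Hausdorff space, $E$ a Banach space, and $H$ a nonzero closed subspace of $C(K,E)$. Let $A\subseteq C(K,\mathbb R)$ be the closed linear span of $\{e^*\circ h: e^*\in E^*, h\in H\}$, and let $A^E$ be the set of those $a\in A$ for which $x\mapsto a(x)e$ belongs to $H$ for every $e\in E$ (if $E=\mathbb R$, then $A=A^E=H$). The Choquet boundary $\operatorname{Ch}_H K$ is the set of those $x\in K$ for which $h\mapsto h(x)$ is an extreme point of the closed unit ball of $A^*$. A point $x\in K$ is a weak peak point with respect to $H$ if for every neighbourhood $U$ of $x$ and every $\varepsilon\in(0,1)$ there is $h\in A^E$ with $0\le h\le 1$, $h(x)>1-\varepsilon$ and $h<\varepsilon$ on $\operatorname{Ch}_H K\setminus U$. The Banach-Mazur distance $d_{BM}(X,Y)$ is the infimum of $\|T\|\,\|T^{-1}\|$ over all surjective linear isomorphisms $T:X\to Y$.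 Then the Choquet boundaries of $H_1$ and $H_2$ are countable and consist of weak peak points, and $d_{BM}(H_1,H_2)=2$. Moreover, the Choquet boundary of $H_2$ is closed, that of $H_1$ is not closed, and the two are not homeomorphic. Consequently, the following theorem fails if the word "closed$^\dagger$" is omitted, and $H_1,H_2$ (with $E_1=E_2=\mathbb R$) is a counterexample. For $i=1,2$, let $K_i$ be a compact Hausdorff space, $E_i$ a Banach space containing no isomorphic copy of $c_0$, and $H_i$ a closed subspace of $C(K_i,E_i)$ such that $\operatorname{Ch}_{H_i}K_i$ is closed$^\dagger$, countable, and consists of weak peak points; suppose that for all natural numbers $m<n$ the space $E_1^m$ contains no isomorphic copy of $E_2^n$ and $E_2^m$ contains no isomorphic copy of $E_1^n$. If there is a surjective isomorphism $T:H_1\to H_2$ with $\|T\|\,\|T^{-1}\|<3$, then $\operatorname{Ch}_{H_1}K_1$ is homeomorphic to $\operatorname{Ch}_{H_2}K_2$. -/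

import Mathlib

set_option maxSynthPendingDepth 3

open Set Topology
open scoped ENNReal ZeroAtInfty

noncomputable section

/-- The canonical scalar function space `A` of a subspace `H` of `C(K, E)`: the closed linear span
of all functions `x ↦ φ (h x)` with `φ ∈ E*` and `h ∈ H`. -/
def canonicalScalar {K E : Type*} [TopologicalSpace K] [CompactSpace K]
    [NormedAddCommGroup E] [NormedSpace ℝ E] (H : Submodule ℝ C(K, E)) :
    Submodule ℝ C(K, ℝ) :=
  (Submodule.span ℝ {g : C(K, ℝ) | ∃ φ : E →L[ℝ] ℝ, ∃ h ∈ H, ∀ x, g x = φ (h x)}).topologicalClosure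

/-- The function `f ⊗ e : x ↦ f x • e`. -/
def tensorVec {K E : Type*} [TopologicalSpace K] [NormedAddCommGroup E] [NormedSpace ℝ E]
    (f : C(K, ℝ)) (e : E) : C(K, E) :=
  ⟨fun x => f x • e, by fun_prop⟩

/-- The set `A^E` of all `a ∈ A` such that `a ⊗ e ∈ H` for every `e ∈ E`. -/
def scalarMultipliers {K E : Type*} [TopologicalSpace K] [CompactSpace K]
    [NormedAddCommGroup E] [NormedSpace ℝ E] (H : Submodule ℝ C(K, E)) : Set C(K, ℝ) :=
  {a | a ∈ canonicalScalar H ∧ ∀ e : E, tensorVec a e ∈ H}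

/-- The evaluation functional `h ↦ h x` on a space `A` of scalar functions. -/
def evalOn {K : Type*} [TopologicalSpace K] [CompactSpace K] (A : Submodule ℝ C(K, ℝ)) (x : K) :
    A →L[ℝ] ℝ :=
  (ContinuousMap.evalCLM ℝ x).comp A.subtypeL

/-- The Choquet boundary of `H`: the points `x` whose evaluation functional is an extreme point
of the closed unit ball of `A*`, where `A` is the canonical scalar function space of `H`. -/
def choquetBoundary {K E : Type*} [TopologicalSpace K] [CompactSpace K]
    [NormedAddCommGroup E] [NormedSpace ℝ E] (H : Submodule ℝ C(K, E)) : Set K :=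
  {x | evalOn (canonicalScalar H) x ∈
    extremePoints ℝ (Metric.closedBall (0 : canonicalScalar H →L[ℝ] ℝ) 1)}

/-- Weak peak points with respect to `H`. -/
def IsWeakPeakPoint {K E : Type*} [TopologicalSpace K] [CompactSpace K]
    [NormedAddCommGroup E] [NormedSpace ℝ E] (H : Submodule ℝ C(K, E)) (x : K) : Prop :=
  ∀ U ∈ 𝓝 x, ∀ ε ∈ Ioo (0 : ℝ) 1, ∃ h ∈ scalarMultipliers H,
    (∀ y, 0 ≤ h y ∧ h y ≤ 1) ∧ 1 - ε < h x ∧ ∀ y ∈ choquetBoundary H \ U, h y < ε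

/-- The Banach-Mazur distance: the infimum of `‖T‖ ‖T⁻¹‖` over all surjective isomorphisms
`T : X → Y` (it is `∞` when there are none). -/
def banachMazurDist (X Y : Type*) [NormedAddCommGroup X] [NormedSpace ℝ X]
    [NormedAddCommGroup Y] [NormedSpace ℝ Y] : ℝ≥0∞ :=
  ⨅ T : X ≃L[ℝ] Y, ENNReal.ofReal (‖(T : X →L[ℝ] Y)‖ * ‖(T.symm : Y →L[ℝ] X)‖)

/-- `X` contains an isomorphic copy of `Y`. -/
def ContainsCopy (X Y : Type*) [NormedAddCommGroup X] [NormedSpace ℝ X]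
    [NormedAddCommGroup Y] [NormedSpace ℝ Y] : Prop :=
  ∃ S : Submodule ℝ X, Nonempty (Y ≃L[ℝ] S)

/-- All hypotheses of the Amir-Cambern type theorem with constant `3` for function spaces with
countable boundaries, EXCEPT the closedness of the two Choquet boundaries: `E₁`, `E₂` are nonzero
and contain no copy of `c₀`; for `m < n`, no `E₁ ^ m` contains a copy of `E₂ ^ n` and vice versa;
`H₁`, `H₂` are nonzero closed subspaces whose Choquet boundaries are countable and consist of weak
peak points; and there is a surjective isomorphism `T : H₁ → H₂` with `‖T‖ ‖T⁻¹‖ < 3`. -/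
def RigidityHypotheses {K₁ K₂ E₁ E₂ : Type*}
    [TopologicalSpace K₁] [CompactSpace K₁] [TopologicalSpace K₂] [CompactSpace K₂]
    [NormedAddCommGroup E₁] [NormedSpace ℝ E₁] [NormedAddCommGroup E₂] [NormedSpace ℝ E₂]
    (H₁ : Submodule ℝ C(K₁, E₁)) (H₂ : Submodule ℝ C(K₂, E₂)) : Prop :=
  Nontrivial E₁ ∧ Nontrivial E₂ ∧
  ¬ ContainsCopy E₁ C₀(ℕ, ℝ) ∧ ¬ ContainsCopy E₂ C₀(ℕ, ℝ) ∧
  (∀ m n : ℕ, m < n →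
    ¬ ContainsCopy (Fin m → E₁) (Fin n → E₂) ∧ ¬ ContainsCopy (Fin m → E₂) (Fin n → E₁)) ∧
  Nontrivial H₁ ∧ Nontrivial H₂ ∧
  IsClosed (H₁ : Set C(K₁, E₁)) ∧ IsClosed (H₂ : Set C(K₂, E₂)) ∧
  (choquetBoundary H₁).Countable ∧ (choquetBoundary H₂).Countable ∧
  (∀ x ∈ choquetBoundary H₁, IsWeakPeakPoint H₁ x) ∧
  (∀ x ∈ choquetBoundary H₂, IsWeakPeakPoint H₂ x) ∧
  ∃ T : H₁ ≃L[ℝ] H₂, ‖(T : H₁ →L[ℝ] H₂)‖ * ‖(T.symm : H₂ →L[ℝ] H₁)‖ < 3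

/-- The ordinal interval `[1, α]`, with the order topology. -/
abbrev OrdinalInterval (α : Ordinal.{0}) : Type 1 := Icc (1 : Ordinal.{0}) α

theorem one_le_omega0_mul_two : (1 : Ordinal.{0}) ≤ Ordinal.omega0 * 2 := by
  rw [Order.one_le_iff_pos]
  exact mul_pos Ordinal.omega0_pos two_pos

/-- The space of all `f ∈ C([1, ω·2])` with `f (ω·2) = 0`. -/
def exampleH₁ : Submodule ℝ C(OrdinalInterval (Ordinal.omega0 * 2), ℝ) where
  carrier := {f | f ⟨Ordinal.omega0 * 2, one_le_omega0_mul_two, le_rfl⟩ = 0}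
  zero_mem' := by simp
  add_mem' := by
    intro f g hf hg
    simp only [mem_ofPred_eq] at hf hg
    simp [hf, hg]
  smul_mem' := by
    intro c f hf
    simp only [mem_ofPred_eq] at hf
    simp [hf]

/-- The space `C([1, ω])`. -/
def exampleH₂ : Submodule ℝ C(OrdinalInterval Ordinal.omega0, ℝ) := ⊤

end

/-!
Both spaces consist of the functions on a compact space `K` that vanish outside an open set `s`:
`s` is `[1, ω·2)` for `H₁` and all of `[1, ω]` for `H₂`. The Choquet boundary of such a space is
`s`, by peak functions supported near a given point of `s`.

If `s` is not closed, every `f` vanishing outside `s` is small somewhere on `s`, hence admits an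
almost disjoint bump `e` of norm one, so that `‖f ± c e‖` is about `max ‖f‖ |c|`. For
`f = T⁻¹ 1`, where `T` maps onto some `C(L)`, take `c = ‖T⁻¹‖`: the functions `1 ± c T e` then have
norm at most about `‖T‖ ‖T⁻¹‖`, while one of them has norm at least `1 + ‖c T e‖ ≥ 2`.

Conversely, `[1, ω·2]` is the disjoint union of two copies of `[0, ω]`, and `[1, ω]` is their wedge
at `ω`, the odd numbers being one copy and the even numbers the other. A pair `(u, v)` with
`v ω = 0` corresponds to the pair `((u + v) / 2, (u - v) / 2)`, which agrees at `ω`; this map has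
norm at most `1` and its inverse `(p, q) ↦ (p + q, p - q)` norm at most `2`.
-/

/-! ### Choquet boundaries -/

theorem canonicalScalar_eq_self {K : Type*} [TopologicalSpace K] [CompactSpace K]
    {H : Submodule ℝ C(K, ℝ)} (hH : IsClosed (H : Set C(K, ℝ))) : canonicalScalar H = H := by
  refine le_antisymm (Submodule.topologicalClosure_minimal _ (Submodule.span_le.2 ?_) hH)
    fun h hh => Submodule.le_topologicalClosure _
      (Submodule.subset_span ⟨ContinuousLinearMap.id ℝ ℝ, h, hh, fun _ => rfl⟩)
  rintro g ⟨φ, h, hh, hg⟩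
  have hgh : g = φ 1 • h := by
    ext x
    rw [hg x, ContinuousMap.smul_apply, smul_eq_mul, mul_comm, ← smul_eq_mul, ← map_smul,
      smul_eq_mul, mul_one]
  exact hgh ▸ H.smul_mem _ hh

theorem scalarMultipliers_eq_self {K : Type*} [TopologicalSpace K] [CompactSpace K]
    {H : Submodule ℝ C(K, ℝ)} (hH : IsClosed (H : Set C(K, ℝ))) :
    scalarMultipliers H = (H : Set C(K, ℝ)) := by
  ext a
  refine ⟨fun ha => canonicalScalar_eq_self hH ▸ ha.1,
    fun ha => ⟨(canonicalScalar_eq_self hH).symm ▸ ha, fun e => ?_⟩⟩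
  have htensor : tensorVec a e = e • a := by
    ext x
    exact mul_comm (a x) e
  exact htensor ▸ H.smul_mem e ha

theorem mem_choquetBoundary_iff_of_isClosed {K : Type*} [TopologicalSpace K] [CompactSpace K]
    {H : Submodule ℝ C(K, ℝ)} (hH : IsClosed (H : Set C(K, ℝ))) {x : K} :
    x ∈ choquetBoundary H ↔ evalOn H x ∈ extremePoints ℝ (Metric.closedBall 0 1) := by
  rw [choquetBoundary, mem_ofPred_eq, canonicalScalar_eq_self hH]

theorem norm_evalOn_le_one {K : Type*} [TopologicalSpace K] [CompactSpace K]
    (A : Submodule ℝ C(K, ℝ)) (x : K) : ‖evalOn A x‖ ≤ 1 :=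
  ContinuousLinearMap.opNorm_le_bound _ zero_le_one fun f => by
    rw [one_mul]
    exact (f : C(K, ℝ)).norm_coe_le_norm x

/-- The subspace of `C(K, ℝ)` of the functions that vanish outside `s`. For `s` open in a locally
compact space this is a copy of `C₀(s)`. Both spaces of the example are of this form. -/
def vanishingOff {K : Type*} [TopologicalSpace K] (s : Set K) : Submodule ℝ C(K, ℝ) :=
  (ContinuousMap.idealOfSet ℝ s).restrictScalars ℝ

section vanishingOff

variable {K : Type*} [TopologicalSpace K] {s : Set K}

theorem mem_vanishingOff {f : C(K, ℝ)} : f ∈ vanishingOff s ↔ ∀ x ∉ s, f x = 0 := Iff.rfl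

theorem vanishingOff_mono {t : Set K} (hst : s ⊆ t) : vanishingOff s ≤ vanishingOff t :=
  fun _ hf x hx => hf x fun hxs => hx (hst hxs)

theorem vanishingOff_univ : vanishingOff (univ : Set K) = ⊤ :=
  eq_top_iff.2 fun _ _ x hx => absurd (mem_univ x) hx

theorem isClosed_vanishingOff (s : Set K) : IsClosed (vanishingOff s : Set C(K, ℝ)) :=
  ContinuousMap.idealOfSet_closed ℝ s

theorem exists_mem_vanishingOff_apply_eq_one [NormalSpace K] [T1Space K] (hs : IsOpen s) {x : K}
    (hx : x ∈ s) : ∃ b ∈ vanishingOff s, b x = 1 ∧ ∀ y, b y ∈ Icc (0 : ℝ) 1 := by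
  obtain ⟨b, hb₀, hb₁, hb⟩ := exists_continuous_zero_one_of_isClosed hs.isClosed_compl
    (isClosed_singleton (x := x)) (disjoint_singleton_right.2 (notMem_compl_iff.2 hx))
  exact ⟨b, hb₀, hb₁ rfl, hb⟩

theorem nontrivial_vanishingOff [NormalSpace K] [T1Space K] (hs : IsOpen s) (hne : s.Nonempty) :
    Nontrivial (vanishingOff s) := by
  obtain ⟨x, hx⟩ := hne
  obtain ⟨b, hb, hbx, -⟩ := exists_mem_vanishingOff_apply_eq_one hs hx
  refine nontrivial_of_ne ⟨b, hb⟩ 0 fun h => one_ne_zero (α := ℝ) ?_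
  have hb0 : b = 0 := congrArg Subtype.val h
  rw [← hbx, hb0, ContinuousMap.zero_apply]

variable [CompactSpace K]

theorem notMem_choquetBoundary_vanishingOff [Nontrivial (vanishingOff s)] {x : K} (hx : x ∉ s) :
    x ∉ choquetBoundary (vanishingOff s) := by
  rw [mem_choquetBoundary_iff_of_isClosed (isClosed_vanishingOff s)]
  intro hext
  obtain ⟨φ, hφ, -⟩ := exists_dual_vector' ℝ (0 : vanishingOff s)
  have : Nontrivial (vanishingOff s →L[ℝ] ℝ) :=
    nontrivial_of_ne φ 0 (norm_ne_zero_iff.1 (hφ ▸ one_ne_zero))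
  have hsphere := mem_sphere_zero_iff_norm.1 (extremePoints_closedBall_subset_sphere hext)
  have hzero : evalOn (vanishingOff s) x = 0 := ContinuousLinearMap.ext fun f => f.2 x hx
  rw [hzero, norm_zero] at hsphere
  exact zero_ne_one hsphere

variable [T2Space K]

theorem apply_eq_zero_of_forall_peak (hs : IsOpen s) {x : K} (hx : x ∈ s)
    {μ : vanishingOff s →L[ℝ] ℝ}
    (hμ : ∀ g : vanishingOff s, ‖g‖ ≤ 1 → (g : C(K, ℝ)) x = 1 → μ g = 1)
    {f : vanishingOff s} (hf : ‖f‖ ≤ 1) (hfx : (f : C(K, ℝ)) x = 0) : μ f = 0 := by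
  obtain ⟨b, hb, hbx, hb01⟩ := exists_mem_vanishingOff_apply_eq_one hs hx
  have hf1 (y : K) : |(f : C(K, ℝ)) y| ≤ 1 := ((f : C(K, ℝ)).norm_coe_le_norm y).trans hf
  -- As `|h| ≤ 1 - |f|`, both `h + f` and `h - f` lie in the unit ball, and they peak at `x`.
  let h : vanishingOff s := ⟨b * (1 - |(f : C(K, ℝ))|), fun y hy => by simp [hb y hy]⟩
  have hh (y : K) : |(h : C(K, ℝ)) y| ≤ 1 - |(f : C(K, ℝ)) y| := by
    change |b y * (1 - |(f : C(K, ℝ)) y|)| ≤ _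
    rw [abs_mul, abs_of_nonneg (hb01 y).1, abs_of_nonneg (sub_nonneg.2 (hf1 y))]
    exact mul_le_of_le_one_left (sub_nonneg.2 (hf1 y)) (hb01 y).2
  have hhx : (h : C(K, ℝ)) x = 1 := by simp [h, hbx, hfx]
  have hadd : μ (h + f) = 1 := by
    refine hμ _ ((ContinuousMap.norm_le _ zero_le_one).2 fun y => ?_) (by simp [hhx, hfx])
    exact (norm_add_le _ _).trans (by simpa using add_le_add_left (hh y) |(f : C(K, ℝ)) y|)
  have hsub : μ (h - f) = 1 := by
    refine hμ _ ((ContinuousMap.norm_le _ zero_le_one).2 fun y => ?_) (by simp [hhx, hfx])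
    exact (norm_sub_le _ _).trans (by simpa using add_le_add_left (hh y) |(f : C(K, ℝ)) y|)
  rw [map_add] at hadd
  rw [map_sub] at hsub
  linarith

theorem eq_evalOn_of_forall_peak (hs : IsOpen s) {x : K} (hx : x ∈ s)
    {μ : vanishingOff s →L[ℝ] ℝ}
    (hμ : ∀ g : vanishingOff s, ‖g‖ ≤ 1 → (g : C(K, ℝ)) x = 1 → μ g = 1) :
    μ = evalOn (vanishingOff s) x := by
  have hker (f : vanishingOff s) (hfx : (f : C(K, ℝ)) x = 0) : μ f = 0 := by
    rcases eq_or_ne f 0 with rfl | hf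
    · exact map_zero μ
    have hscaled : μ (‖f‖⁻¹ • f) = 0 :=
      apply_eq_zero_of_forall_peak hs hx hμ (norm_smul_inv_norm hf).le (by simp [hfx])
    rw [map_smul, smul_eq_mul] at hscaled
    exact (mul_eq_zero.1 hscaled).resolve_left (inv_ne_zero (norm_ne_zero_iff.2 hf))
  obtain ⟨b, hb, hbx, hb01⟩ := exists_mem_vanishingOff_apply_eq_one hs hx
  have hμb : μ ⟨b, hb⟩ = 1 :=
    hμ _ ((ContinuousMap.norm_le _ zero_le_one).2 fun y =>
      (Real.norm_of_nonneg (hb01 y).1).trans_le (hb01 y).2) hbx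
  ext f
  have hf := hker (f - (f : C(K, ℝ)) x • ⟨b, hb⟩) (by simp [hbx])
  rwa [map_sub, map_smul, hμb, smul_eq_mul, mul_one, sub_eq_zero] at hf

theorem mem_choquetBoundary_vanishingOff (hs : IsOpen s) {x : K} (hx : x ∈ s) :
    x ∈ choquetBoundary (vanishingOff s) := by
  rw [mem_choquetBoundary_iff_of_isClosed (isClosed_vanishingOff s), mem_extremePoints_iff_left]
  refine ⟨mem_closedBall_zero_iff.2 (norm_evalOn_le_one _ x), fun μ hμ ν hν hseg => ?_⟩
  refine eq_evalOn_of_forall_peak hs hx fun g hg hgx => ?_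
  have hball {φ : vanishingOff s →L[ℝ] ℝ} (hφ : φ ∈ Metric.closedBall 0 1) :
      φ g ∈ Metric.closedBall (0 : ℝ) 1 :=
    mem_closedBall_zero_iff.2 (φ.unit_le_opNorm g hg |>.trans (mem_closedBall_zero_iff.1 hφ))
  have hone : (1 : ℝ) ∈ extremePoints ℝ (Metric.closedBall 0 1) :=
    StrictConvexSpace.sphere_subset_extremePoints_closedBall 0 one_ne_zero (by simp)
  refine (mem_extremePoints_iff_left.1 hone).2 _ (hball hμ) _ (hball hν) ?_
  obtain ⟨a, b, ha, hb, hab, heval⟩ := hseg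
  exact ⟨a, b, ha, hb, hab, (DFunLike.congr_fun heval g).trans hgx⟩

theorem choquetBoundary_vanishingOff (hs : IsOpen s) (hne : s.Nonempty) :
    choquetBoundary (vanishingOff s) = s :=
  have := nontrivial_vanishingOff hs hne
  Subset.antisymm (fun _ => not_imp_not.1 notMem_choquetBoundary_vanishingOff)
    fun _ => mem_choquetBoundary_vanishingOff hs

theorem isWeakPeakPoint_vanishingOff (hs : IsOpen s) {x : K} (hx : x ∈ s) :
    IsWeakPeakPoint (vanishingOff s) x := by
  intro U hU ε hε
  obtain ⟨b, hb, hbx, hb01⟩ := exists_mem_vanishingOff_apply_eq_one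
    (hs.inter isOpen_interior) ⟨hx, mem_interior_iff_mem_nhds.2 hU⟩
  rw [scalarMultipliers_eq_self (isClosed_vanishingOff s)]
  refine ⟨b, vanishingOff_mono inter_subset_left hb, hb01, ?_, fun y hy => ?_⟩
  · linarith [hε.1]
  · rw [hb y fun hyU => hy.2 (interior_subset hyU.2)]
    exact hε.1

end vanishingOff

/-! ### The Banach–Mazur distance -/

theorem banachMazurDist_le_ofReal_mul {X Y : Type*} [NormedAddCommGroup X] [NormedSpace ℝ X]
    [NormedAddCommGroup Y] [NormedSpace ℝ Y] (e : X ≃ₗ[ℝ] Y) {C D : ℝ} (hC : 0 ≤ C) (hD : 0 ≤ D)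
    (he : ∀ x, ‖e x‖ ≤ C * ‖x‖) (he' : ∀ y, ‖e.symm y‖ ≤ D * ‖y‖) :
    banachMazurDist X Y ≤ ENNReal.ofReal (C * D) :=
  (iInf_le _ (e.toContinuousLinearEquivOfBounds C D he he')).trans <| ENNReal.ofReal_le_ofReal <|
    mul_le_mul (ContinuousLinearMap.opNorm_le_bound _ hC he)
      (ContinuousLinearMap.opNorm_le_bound _ hD he') (norm_nonneg _) hC

theorem banachMazurDist_congr_right {X Y Z : Type*} [NormedAddCommGroup X] [NormedSpace ℝ X]
    [NormedAddCommGroup Y] [NormedSpace ℝ Y] [NormedAddCommGroup Z] [NormedSpace ℝ Z]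
    (e : Y ≃ₗᵢ[ℝ] Z) : banachMazurDist X Y = banachMazurDist X Z := by
  refine Equiv.iInf_congr
    ⟨fun T => T.trans e.toContinuousLinearEquiv, fun T => T.trans e.symm.toContinuousLinearEquiv,
      fun T => by ext; simp, fun T => by ext; simp⟩ fun T => ?_
  have hcomp : ‖(T.trans e.toContinuousLinearEquiv : X →L[ℝ] Z)‖ = ‖(T : X →L[ℝ] Y)‖ := by
    have h : (T.trans e.toContinuousLinearEquiv : X →L[ℝ] Z) =
      e.toLinearIsometry.toContinuousLinearMap.comp (T : X →L[ℝ] Y) := rfl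
    rw [h, LinearIsometry.norm_toContinuousLinearMap_comp]
  have hcomp_symm : ‖((T.trans e.toContinuousLinearEquiv).symm : Z →L[ℝ] X)‖ =
      ‖(T.symm : Y →L[ℝ] X)‖ :=
    (T.symm : Y →L[ℝ] X).opNorm_comp_linearIsometryEquiv e.symm
  simp only [Equiv.coe_fn_mk, hcomp, hcomp_symm]

theorem one_add_norm_le_max_norm {L : Type*} [TopologicalSpace L] [CompactSpace L] [Nonempty L]
    (g : C(L, ℝ)) : 1 + ‖g‖ ≤ max ‖1 + g‖ ‖1 - g‖ := by
  rw [← le_sub_iff_add_le', ContinuousMap.norm_le_of_nonempty]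
  intro x
  have hadd : 1 + g x ≤ ‖1 + g‖ := (le_abs_self _).trans ((1 + g).norm_coe_le_norm x)
  have hsub : 1 - g x ≤ ‖1 - g‖ := (le_abs_self _).trans ((1 - g).norm_coe_le_norm x)
  rw [le_sub_iff_add_le', Real.norm_eq_abs]
  rcases le_total 0 (g x) with hx | hx
  · exact le_max_of_le_left (by rwa [abs_of_nonneg hx])
  · exact le_max_of_le_right (by rwa [abs_of_nonpos hx, ← sub_eq_add_neg])

section LowerBound

variable {K : Type*} [TopologicalSpace K] {s : Set K}

theorem exists_mem_abs_lt_of_not_isClosed (hs : ¬ IsClosed s) {f : C(K, ℝ)}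
    (hf : f ∈ vanishingOff s) {ε : ℝ} (hε : 0 < ε) : ∃ x ∈ s, |f x| < ε := by
  contrapose! hs
  have hs_eq : s = {x | ε ≤ |f x|} :=
    Subset.antisymm hs fun x hx => by_contra fun hxs =>
      hε.not_ge (by simpa [mem_vanishingOff.1 hf x hxs] using hx)
  rw [hs_eq]
  exact isClosed_le continuous_const f.continuous.abs

variable [CompactSpace K] [T2Space K]

theorem exists_norm_eq_one_norm_add_smul_le (ho : IsOpen s) (hc : ¬ IsClosed s)
    (f : vanishingOff s) {ε : ℝ} (hε : 0 < ε) :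
    ∃ e : vanishingOff s, ‖e‖ = 1 ∧ ∀ c : ℝ, ‖f + c • e‖ ≤ max ‖f‖ (|c| + ε) := by
  obtain ⟨x, hxs, hfx⟩ := exists_mem_abs_lt_of_not_isClosed hc f.2 hε
  have hsmall : IsOpen {y | |(f : C(K, ℝ)) y| < ε} :=
    isOpen_lt (f : C(K, ℝ)).continuous.abs continuous_const
  obtain ⟨b, hb, hbx, hb01⟩ := exists_mem_vanishingOff_apply_eq_one (ho.inter hsmall) ⟨hxs, hfx⟩
  refine ⟨⟨b, vanishingOff_mono inter_subset_left hb⟩, le_antisymm ?_ ?_, fun c => ?_⟩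
  · exact (ContinuousMap.norm_le _ zero_le_one).2 fun y =>
      (Real.norm_of_nonneg (hb01 y).1).trans_le (hb01 y).2
  · simpa [hbx] using b.norm_coe_le_norm x
  · refine (ContinuousMap.norm_le _ (le_max_of_le_left (norm_nonneg f))).2 fun y => ?_
    change |(f : C(K, ℝ)) y + c * b y| ≤ _
    by_cases hy : |(f : C(K, ℝ)) y| < ε
    · refine le_max_of_le_right ((abs_add_le _ _).trans ?_)
      rw [abs_mul, abs_of_nonneg (hb01 y).1, add_comm]
      exact add_le_add (mul_le_of_le_one_right (abs_nonneg c) (hb01 y).2) hy.le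
    · rw [hb y fun h => hy h.2, mul_zero, add_zero]
      exact le_max_of_le_left ((f : C(K, ℝ)).norm_coe_le_norm y)

variable {L : Type*} [TopologicalSpace L] [CompactSpace L] [Nonempty L]

theorem two_le_norm_mul_norm_symm_add (ho : IsOpen s) (hc : ¬ IsClosed s)
    (T : vanishingOff s ≃L[ℝ] C(L, ℝ)) {ε : ℝ} (hε : 0 < ε) :
    2 ≤ ‖(T : vanishingOff s →L[ℝ] C(L, ℝ))‖ *
      (‖(T.symm : C(L, ℝ) →L[ℝ] vanishingOff s)‖ + ε) := by
  set M := ‖(T : vanishingOff s →L[ℝ] C(L, ℝ))‖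
  set N := ‖(T.symm : C(L, ℝ) →L[ℝ] vanishingOff s)‖
  have hN : 0 ≤ N := norm_nonneg _
  obtain ⟨e, he, hfe⟩ := exists_norm_eq_one_norm_add_smul_le ho hc (T.symm 1) hε
  have hf : ‖T.symm 1‖ ≤ N := (T.symm : C(L, ℝ) →L[ℝ] vanishingOff s).unit_le_opNorm 1 norm_one.le
  have hTe : 1 ≤ ‖N • T e‖ := by
    rw [norm_smul, Real.norm_of_nonneg hN]
    simpa [he] using (T.symm : C(L, ℝ) →L[ℝ] vanishingOff s).le_opNorm (T e)
  have hbound {c : ℝ} (hcN : |c| = N) : ‖1 + c • T e‖ ≤ M * (N + ε) :=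
    calc ‖1 + c • T e‖ = ‖T (T.symm 1 + c • e)‖ := by simp
      _ ≤ M * ‖T.symm 1 + c • e‖ := (T : vanishingOff s →L[ℝ] C(L, ℝ)).le_opNorm _
      _ ≤ M * (N + ε) := by
        refine mul_le_mul_of_nonneg_left ((hfe c).trans (max_le ?_ ?_)) (norm_nonneg _)
        · linarith
        · rw [hcN]
  have hadd : ‖1 + N • T e‖ ≤ M * (N + ε) := hbound (abs_of_nonneg hN)
  have hsub : ‖1 - N • T e‖ ≤ M * (N + ε) := by
    rw [sub_eq_add_neg, ← neg_smul]
    exact hbound (by rw [abs_neg, abs_of_nonneg hN])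
  linarith [(one_add_norm_le_max_norm (N • T e)).trans (max_le hadd hsub)]

theorem two_le_norm_mul_norm_symm (ho : IsOpen s) (hc : ¬ IsClosed s)
    (T : vanishingOff s ≃L[ℝ] C(L, ℝ)) :
    2 ≤ ‖(T : vanishingOff s →L[ℝ] C(L, ℝ))‖ * ‖(T.symm : C(L, ℝ) →L[ℝ] vanishingOff s)‖ := by
  refine le_of_forall_pos_le_add fun δ hδ => ?_
  obtain ⟨ε, hε, hMε⟩ := exists_pos_mul_lt hδ ‖(T : vanishingOff s →L[ℝ] C(L, ℝ))‖
  linarith [two_le_norm_mul_norm_symm_add ho hc T hε]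

theorem two_le_banachMazurDist (ho : IsOpen s) (hc : ¬ IsClosed s) :
    2 ≤ banachMazurDist (vanishingOff s) C(L, ℝ) := by
  refine le_iInf fun T => ?_
  rw [← ENNReal.ofReal_ofNat]
  exact ENNReal.ofReal_le_ofReal (two_le_norm_mul_norm_symm ho hc T)

end LowerBound

/-- `a` and `b` exhibit `Z` as the double of `L` along `F`, that is, as two copies of `L` glued
along `F`. For `F = ∅` this is the disjoint union of two copies, for a singleton the wedge. -/
structure IsDouble {L Z : Type*} [TopologicalSpace L] [TopologicalSpace Z] (a b : C(L, Z))
    (F : Set L) : Prop where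
  injective_left : Function.Injective a
  injective_right : Function.Injective b
  eq_iff : ∀ x y, a x = b y ↔ x = y ∧ x ∈ F
  mem_range : ∀ z, z ∈ range a ∪ range b

namespace IsDouble

variable {L Z : Type*} [TopologicalSpace L] [TopologicalSpace Z] {a b : C(L, Z)} {F : Set L}

theorem forall_iff (h : IsDouble a b F) {P : Z → Prop} :
    (∀ z, P z) ↔ ∀ x, P (a x) ∧ P (b x) := by
  refine ⟨fun hP x => ⟨hP _, hP _⟩, fun hP z => ?_⟩
  rcases h.mem_range z with ⟨x, rfl⟩ | ⟨x, rfl⟩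
  exacts [(hP x).1, (hP x).2]

theorem isQuotientMap_sumElim [CompactSpace L] [T2Space Z] (h : IsDouble a b F) :
    IsQuotientMap (Sum.elim a b) :=
  .of_surjective_continuous
    (h.forall_iff.2 fun x => ⟨⟨.inl x, rfl⟩, ⟨.inr x, rfl⟩⟩)
    (a.continuous.sumElim b.continuous)

theorem exists_glue [CompactSpace L] [T2Space Z] (h : IsDouble a b F) {Y : Type*}
    [TopologicalSpace Y] {u v : C(L, Y)} (huv : EqOn u v F) :
    ∃ g : C(Z, Y), g.comp a = u ∧ g.comp b = v := by
  have hcompat : ∀ p q, Sum.elim a b p = Sum.elim a b q → Sum.elim u v p = Sum.elim u v q := by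
    rintro (x | x) (y | y) hxy
    · exact congrArg u (h.injective_left hxy)
    · obtain ⟨rfl, hx⟩ := (h.eq_iff x y).1 hxy
      exact huv hx
    · obtain ⟨rfl, hy⟩ := (h.eq_iff y x).1 hxy.symm
      exact (huv hy).symm
    · exact congrArg v (h.injective_right hxy)
  let w : C(L ⊕ L, Y) := ⟨Sum.elim u v, u.continuous.sumElim v.continuous⟩
  let q : C(L ⊕ L, Z) := ⟨Sum.elim a b, a.continuous.sumElim b.continuous⟩
  have hq : IsQuotientMap q := h.isQuotientMap_sumElim
  refine ⟨hq.lift w hcompat, ?_, ?_⟩ <;> ext x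
  · exact DFunLike.congr_fun (hq.lift_comp w hcompat) (Sum.inl x)
  · exact DFunLike.congr_fun (hq.lift_comp w hcompat) (Sum.inr x)

/-- The function on the double `Z` that is `u` on the first copy of `L` and `v` on the second. -/
noncomputable def glue [CompactSpace L] [T2Space Z] (h : IsDouble a b F) {Y : Type*}
    [TopologicalSpace Y] {u v : C(L, Y)} (huv : EqOn u v F) : C(Z, Y) :=
  (h.exists_glue huv).choose

section glue

variable [CompactSpace L] [T2Space Z] (h : IsDouble a b F) {Y : Type*} [TopologicalSpace Y]
  {u v : C(L, Y)} (huv : EqOn u v F)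

@[simp]
theorem glue_left (x : L) : h.glue huv (a x) = u x :=
  DFunLike.congr_fun (h.exists_glue huv).choose_spec.1 x

@[simp]
theorem glue_right (x : L) : h.glue huv (b x) = v x :=
  DFunLike.congr_fun (h.exists_glue huv).choose_spec.2 x

end glue

section foldEquiv

variable {K : Type*} [TopologicalSpace K] {c d : C(L, K)}

theorem eqOn_half_add_half_sub {f : C(K, ℝ)} (hf : f ∈ vanishingOff (d '' F)ᶜ) :
    EqOn ((2⁻¹ : ℝ) • (f.comp c + f.comp d) : C(L, ℝ))
      ((2⁻¹ : ℝ) • (f.comp c - f.comp d) : C(L, ℝ)) F := by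
  intro x hx
  have hfx : f (d x) = 0 := hf _ (not_not_intro (mem_image_of_mem d hx))
  simp [hfx]

variable [T2Space K] [CompactSpace L] [T2Space Z]

/-- The isomorphism between the functions on `K = L ⊔ L` that vanish on the second copy of `F` and
the functions on the double `Z` of `L` along `F`, given by half the sum and half the difference of
the two restrictions to `L`. -/
noncomputable def foldEquiv (hK : IsDouble c d ∅) (hZ : IsDouble a b F) :
    vanishingOff (d '' F)ᶜ ≃ₗ[ℝ] C(Z, ℝ) where
  toFun f := hZ.glue (eqOn_half_add_half_sub f.2 (c := c))
  map_add' f g := by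
    refine ContinuousMap.ext (hZ.forall_iff.2 fun x => ⟨?_, ?_⟩) <;>
      simp only [glue_left, glue_right, Submodule.coe_add, ContinuousMap.add_apply,
        ContinuousMap.sub_apply, ContinuousMap.smul_apply, ContinuousMap.comp_apply,
        smul_eq_mul] <;> ring
  map_smul' r f := by
    refine ContinuousMap.ext (hZ.forall_iff.2 fun x => ⟨?_, ?_⟩) <;>
      simp only [glue_left, glue_right, SetLike.val_smul, RingHom.id_apply,
        ContinuousMap.add_apply, ContinuousMap.sub_apply, ContinuousMap.smul_apply,
        ContinuousMap.comp_apply, smul_eq_mul] <;> ring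
  invFun g := ⟨hK.glue (u := g.comp a + g.comp b) (v := g.comp a - g.comp b) (eqOn_empty _ _), by
    intro z hz
    obtain ⟨x, hx, rfl⟩ := not_not.1 hz
    simp [(hZ.eq_iff x x).2 ⟨rfl, hx⟩]⟩
  left_inv f := by
    refine Subtype.ext (ContinuousMap.ext (hK.forall_iff.2 fun x => ⟨?_, ?_⟩)) <;>
      simp only [glue_left, glue_right, ContinuousMap.add_apply, ContinuousMap.sub_apply,
        ContinuousMap.smul_apply, ContinuousMap.comp_apply, smul_eq_mul] <;> ring
  right_inv g := by
    refine ContinuousMap.ext (hZ.forall_iff.2 fun x => ⟨?_, ?_⟩) <;>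
      simp only [glue_left, glue_right, ContinuousMap.add_apply, ContinuousMap.sub_apply,
        ContinuousMap.smul_apply, ContinuousMap.comp_apply, smul_eq_mul] <;> ring

theorem foldEquiv_left (hK : IsDouble c d ∅) (hZ : IsDouble a b F)
    (f : vanishingOff (d '' F)ᶜ) (x : L) :
    hK.foldEquiv hZ f (a x) = 2⁻¹ * ((f : C(K, ℝ)) (c x) + (f : C(K, ℝ)) (d x)) :=
  hZ.glue_left (eqOn_half_add_half_sub f.2) x

theorem foldEquiv_right (hK : IsDouble c d ∅) (hZ : IsDouble a b F)
    (f : vanishingOff (d '' F)ᶜ) (x : L) :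
    hK.foldEquiv hZ f (b x) = 2⁻¹ * ((f : C(K, ℝ)) (c x) - (f : C(K, ℝ)) (d x)) :=
  hZ.glue_right (eqOn_half_add_half_sub f.2) x

theorem foldEquiv_symm_left (hK : IsDouble c d ∅) (hZ : IsDouble a b F) (g : C(Z, ℝ)) (x : L) :
    ((hK.foldEquiv hZ).symm g : C(K, ℝ)) (c x) = g (a x) + g (b x) :=
  hK.glue_left (u := g.comp a + g.comp b) (v := g.comp a - g.comp b) (eqOn_empty _ _) x

theorem foldEquiv_symm_right (hK : IsDouble c d ∅) (hZ : IsDouble a b F) (g : C(Z, ℝ)) (x : L) :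
    ((hK.foldEquiv hZ).symm g : C(K, ℝ)) (d x) = g (a x) - g (b x) :=
  hK.glue_right (u := g.comp a + g.comp b) (v := g.comp a - g.comp b) (eqOn_empty _ _) x

variable [CompactSpace K] [CompactSpace Z]

theorem norm_foldEquiv_le (hK : IsDouble c d ∅) (hZ : IsDouble a b F)
    (f : vanishingOff (d '' F)ᶜ) : ‖hK.foldEquiv hZ f‖ ≤ 1 * ‖f‖ := by
  rw [one_mul, ContinuousMap.norm_le _ (norm_nonneg f), hZ.forall_iff]
  intro x
  have hc := abs_le.1 ((f : C(K, ℝ)).norm_coe_le_norm (c x))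
  have hd := abs_le.1 ((f : C(K, ℝ)).norm_coe_le_norm (d x))
  rw [← Submodule.coe_norm] at hc hd
  rw [foldEquiv_left, foldEquiv_right, Real.norm_eq_abs, Real.norm_eq_abs, abs_le, abs_le]
  refine ⟨⟨?_, ?_⟩, ?_, ?_⟩ <;> linarith

theorem norm_foldEquiv_symm_le (hK : IsDouble c d ∅) (hZ : IsDouble a b F) (g : C(Z, ℝ)) :
    ‖(hK.foldEquiv hZ).symm g‖ ≤ 2 * ‖g‖ := by
  rw [Submodule.coe_norm, ContinuousMap.norm_le _ (by positivity), hK.forall_iff]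
  intro x
  have ha : ‖g (a x)‖ ≤ ‖g‖ := g.norm_coe_le_norm (a x)
  have hb : ‖g (b x)‖ ≤ ‖g‖ := g.norm_coe_le_norm (b x)
  rw [foldEquiv_symm_left, foldEquiv_symm_right, two_mul]
  exact ⟨norm_add_le_of_le ha hb, norm_sub_le_of_le ha hb⟩

theorem banachMazurDist_le_two (hK : IsDouble c d ∅) (hZ : IsDouble a b F) :
    banachMazurDist (vanishingOff (d '' F)ᶜ) C(Z, ℝ) ≤ 2 := by
  simpa using banachMazurDist_le_ofReal_mul (hK.foldEquiv hZ) zero_le_one zero_le_two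
    (norm_foldEquiv_le hK hZ) (norm_foldEquiv_symm_le hK hZ)

end foldEquiv

end IsDouble

theorem isEmpty_homeomorph_of_not_isClosed {X Y : Type*} [TopologicalSpace X] [T2Space X]
    [TopologicalSpace Y] [CompactSpace Y] {s : Set X} (hs : ¬ IsClosed s) : IsEmpty (s ≃ₜ Y) :=
  ⟨fun e => hs (isCompact_iff_compactSpace.2 e.symm.compactSpace).isClosed⟩

section ContainsCopy

variable {X Y : Type*} [NormedAddCommGroup X] [NormedSpace ℝ X] [NormedAddCommGroup Y]
  [NormedSpace ℝ Y]

theorem ContainsCopy.exists_injective (h : ContainsCopy X Y) :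
    ∃ f : Y →ₗ[ℝ] X, Function.Injective f := by
  obtain ⟨S, ⟨e⟩⟩ := h
  exact ⟨S.subtype ∘ₗ e.toLinearEquiv, S.injective_subtype.comp e.injective⟩

theorem not_containsCopy_of_finrank_lt [FiniteDimensional ℝ X]
    (h : Module.finrank ℝ X < Module.finrank ℝ Y) : ¬ ContainsCopy X Y := fun hXY => by
  obtain ⟨f, hf⟩ := hXY.exists_injective
  exact h.not_ge (LinearMap.finrank_le_finrank_of_injective hf)

theorem not_finiteDimensional_zeroAtInfty : ¬ FiniteDimensional ℝ C₀(ℕ, ℝ) := by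
  let e (n : ℕ) : C₀(ℕ, ℝ) :=
    ⟨⟨Pi.single n 1, continuous_of_discreteTopology⟩,
      (HasCompactSupport.of_support_subset_isCompact (K := {n}) isCompact_singleton
        (Pi.support_single_subset)).is_zero_at_infty⟩
  let coe : C₀(ℕ, ℝ) →ₗ[ℝ] ℕ → ℝ := ⟨⟨fun f => f, fun _ _ => rfl⟩, fun _ _ => rfl⟩
  have he : LinearIndependent ℝ e :=
    LinearIndependent.of_comp coe (Pi.linearIndependent_single_one ℕ ℝ)
  exact fun _ => not_finite_iff_infinite.2 (inferInstanceAs (Infinite ℕ)) he.finite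

theorem not_containsCopy_zeroAtInfty [FiniteDimensional ℝ X] : ¬ ContainsCopy X C₀(ℕ, ℝ) :=
  fun h => by
    obtain ⟨f, hf⟩ := h.exists_injective
    exact not_finiteDimensional_zeroAtInfty (.of_injective f hf)

end ContainsCopy

theorem rigidityHypotheses_vanishingOff {K₁ K₂ : Type*} [TopologicalSpace K₁] [CompactSpace K₁]
    [T2Space K₁] [TopologicalSpace K₂] [CompactSpace K₂] [T2Space K₂] {s : Set K₁} {t : Set K₂}
    (hs : IsOpen s) (hs_ne : s.Nonempty) (hs_countable : s.Countable)
    (ht : IsOpen t) (ht_ne : t.Nonempty) (ht_countable : t.Countable)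
    (hdist : banachMazurDist (vanishingOff s) (vanishingOff t) < 3) :
    RigidityHypotheses (vanishingOff s) (vanishingOff t) := by
  have hpow (m n : ℕ) (h : m < n) : ¬ ContainsCopy (Fin m → ℝ) (Fin n → ℝ) :=
    not_containsCopy_of_finrank_lt (by simpa using h)
  obtain ⟨T, hT⟩ := iInf_lt_iff.1 hdist
  rw [ENNReal.ofReal_lt_ofNat] at hT
  rw [RigidityHypotheses, choquetBoundary_vanishingOff hs hs_ne,
    choquetBoundary_vanishingOff ht ht_ne]
  exact ⟨inferInstance, inferInstance, not_containsCopy_zeroAtInfty, not_containsCopy_zeroAtInfty,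
    fun m n h => ⟨hpow m n h, hpow m n h⟩, nontrivial_vanishingOff hs hs_ne,
    nontrivial_vanishingOff ht ht_ne, isClosed_vanishingOff s, isClosed_vanishingOff t,
    hs_countable, ht_countable, fun _ => isWeakPeakPoint_vanishingOff hs,
    fun _ => isWeakPeakPoint_vanishingOff ht, T, hT⟩

/-! ### Ordinal intervals -/

section OrdinalIntervals

open Order
open Ordinal hiding univ

theorem countable_ordinalInterval {α : Ordinal.{0}} (hα : α.card ≤ Cardinal.aleph0) :
    Countable (OrdinalInterval α) := by
  have hIio : (Iio (α + 1)).Countable := by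
    rw [← Cardinal.le_aleph0_iff_set_countable, Cardinal.mk_Iio_ordinal, Cardinal.lift_le_aleph0,
      card_add, card_one]
    exact Cardinal.add_le_aleph0.2 ⟨hα, Cardinal.one_le_aleph0⟩
  exact (hIio.mono fun x hx => lt_add_one_iff.2 hx.2).to_subtype

theorem not_isClosed_compl_singleton_ordinalInterval {α : Ordinal.{0}} (hα : IsSuccLimit α)
    (h : 1 ≤ α) : ¬ IsClosed ({⟨α, h, le_rfl⟩}ᶜ : Set (OrdinalInterval α)) := by
  rw [isClosed_compl_iff]
  intro hopen
  have hone : 1 < α := one_lt_of_isSuccLimit hα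
  obtain ⟨l, hl, hsub⟩ := exists_Ioc_subset_of_mem_nhds (hopen.mem_nhds rfl)
    ⟨⟨1, le_rfl, h⟩, hone⟩
  have hsucc : (l : Ordinal) + 1 < α := hα.add_one_lt hl
  have hmem : (⟨l + 1, l.2.1.trans (lt_add_one _).le, hsucc.le⟩ : OrdinalInterval α) ∈
      Ioc l ⟨α, h, le_rfl⟩ := ⟨lt_add_one (l : Ordinal), hsucc.le⟩
  exact hsucc.ne (congrArg Subtype.val (hsub hmem))

/-- The map `x ↦ γ + δ * x` from `[0, β]` to `[1, α]`. -/
def ordinalAffine {α β γ δ : Ordinal.{0}} (hγ : 1 ≤ γ) (hδ : 0 < δ) (h : γ + δ * β ≤ α) :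
    C(Icc 0 β, OrdinalInterval α) where
  toFun x := ⟨γ + δ * x, hγ.trans le_self_add,
    ((isNormal_add_right γ).comp (isNormal_mul_right hδ)).strictMono.monotone x.2.2 |>.trans h⟩
  continuous_toFun :=
    (((isNormal_add_right γ).comp (isNormal_mul_right hδ)).continuous.comp
      continuous_subtype_val).subtype_mk _

theorem ordinalAffine_injective {α β γ δ : Ordinal.{0}} (hγ : 1 ≤ γ) (hδ : 0 < δ)
    (h : γ + δ * β ≤ α) : Function.Injective (ordinalAffine hγ hδ h) := fun _ _ hxy =>
  Subtype.ext (((isNormal_add_right γ).comp (isNormal_mul_right hδ)).strictMono.injective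
    (congrArg Subtype.val hxy))

theorem add_mul_omega0 {γ δ : Ordinal.{0}} (hγ : γ < ω) (hδ : 0 < δ) (hδω : δ < ω) :
    γ + δ * ω = ω := by
  rw [mul_omega0 hδ hδω, add_omega0 hγ]

theorem add_one_add_omega0 : ω + 1 + ω = ω * (2 : Ordinal.{0}) := by
  rw [add_assoc, one_add_omega0, Ordinal.mul_two]

/-- The embedding `[0, ω] → [1, ω]` onto the odd numbers and `ω`. -/
def oddMap : C(Icc 0 ω, OrdinalInterval ω) :=
  ordinalAffine (γ := 1) (δ := 2) le_rfl two_pos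
    (add_mul_omega0 one_lt_omega0 two_pos (natCast_lt_omega0 2)).le

/-- The embedding `[0, ω] → [1, ω]` onto the positive even numbers and `ω`. -/
def evenMap : C(Icc 0 ω, OrdinalInterval ω) :=
  ordinalAffine (γ := 2) (δ := 2) one_le_two two_pos
    (add_mul_omega0 (natCast_lt_omega0 2) two_pos (natCast_lt_omega0 2)).le

/-- The embedding `[0, ω] → [1, ω * 2]` onto `[1, ω]`. -/
def lowerMap : C(Icc 0 ω, OrdinalInterval (ω * 2)) :=
  ordinalAffine (γ := 1) (δ := 1) le_rfl one_pos
    ((add_mul_omega0 one_lt_omega0 one_pos one_lt_omega0).trans_le (le_mul_left _ two_pos))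

/-- The embedding `[0, ω] → [1, ω * 2]` onto `[ω + 1, ω * 2]`. -/
def upperMap : C(Icc 0 ω, OrdinalInterval (ω * 2)) :=
  ordinalAffine (γ := ω + 1) (δ := 1) le_add_self one_pos
    (by rw [one_mul, add_one_add_omega0])

theorem oddMap_eq_evenMap_iff (x y : Icc 0 ω) :
    oddMap x = evenMap y ↔ x = y ∧ (x : Ordinal) = ω := by
  have hω {n : ℕ} : (n : Ordinal.{0}) ≠ ω := (natCast_lt_omega0 n).ne
  have hodd : 1 + 2 * ω = ω := add_mul_omega0 one_lt_omega0 two_pos (natCast_lt_omega0 2)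
  have heven : 2 + 2 * ω = ω :=
    add_mul_omega0 (natCast_lt_omega0 2) two_pos (natCast_lt_omega0 2)
  obtain ⟨x, -, hx⟩ := x
  obtain ⟨y, -, hy⟩ := y
  rw [Subtype.ext_iff, Subtype.ext_iff]
  change 1 + 2 * x = 2 + 2 * y ↔ x = y ∧ x = ω
  rcases hx.lt_or_eq with hx | rfl <;> rcases hy.lt_or_eq with hy | rfl
  · obtain ⟨m, rfl⟩ := lt_omega0.1 hx
    obtain ⟨n, rfl⟩ := lt_omega0.1 hy
    simp only [hω, and_false, iff_false]
    norm_cast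
    omega
  · obtain ⟨m, rfl⟩ := lt_omega0.1 hx
    rw [heven]
    simp only [hω, and_false, iff_false]
    exact_mod_cast hω
  · obtain ⟨n, rfl⟩ := lt_omega0.1 hy
    rw [hodd]
    simp only [hω.symm, and_true, iff_false]
    exact_mod_cast hω.symm
  · simp [hodd, heven]

theorem isDouble_oddMap_evenMap :
    IsDouble oddMap evenMap {⟨ω, omega0_pos.le, le_rfl⟩} where
  injective_left := ordinalAffine_injective _ _ _
  injective_right := ordinalAffine_injective _ _ _
  eq_iff x y := (oddMap_eq_evenMap_iff x y).trans
    (and_congr_right' ⟨fun hx => Subtype.ext hx, congrArg Subtype.val⟩)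
  mem_range := by
    rintro ⟨z, hz₁, hzω⟩
    rcases hzω.lt_or_eq with hz | rfl
    · obtain ⟨n, rfl⟩ := lt_omega0.1 hz
      have hn : 1 ≤ n := by exact_mod_cast hz₁
      obtain ⟨k, hk | hk⟩ : ∃ k, n = 1 + 2 * k ∨ n = 2 + 2 * k := ⟨(n - 1) / 2, by omega⟩
      · refine .inl ⟨⟨k, zero_le, (natCast_lt_omega0 k).le⟩, Subtype.ext ?_⟩
        change 1 + 2 * (k : Ordinal) = n
        exact_mod_cast hk.symm
      · refine .inr ⟨⟨k, zero_le, (natCast_lt_omega0 k).le⟩, Subtype.ext ?_⟩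
        change 2 + 2 * (k : Ordinal) = n
        exact_mod_cast hk.symm
    · exact .inl ⟨⟨ω, zero_le, le_rfl⟩,
        Subtype.ext (add_mul_omega0 one_lt_omega0 two_pos (natCast_lt_omega0 2))⟩

theorem isDouble_lowerMap_upperMap : IsDouble lowerMap upperMap ∅ where
  injective_left := ordinalAffine_injective _ _ _
  injective_right := ordinalAffine_injective _ _ _
  eq_iff x y := by
    have hlower : (lowerMap x : Ordinal) ≤ ω :=
      calc 1 + 1 * (x : Ordinal) ≤ 1 + 1 * ω := by gcongr; exact x.2.2
        _ = ω := add_mul_omega0 one_lt_omega0 one_pos one_lt_omega0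
    have hupper : ω < (upperMap y : Ordinal) := (lt_add_one ω).trans_le le_self_add
    have hne : lowerMap x ≠ upperMap y := fun h =>
      (hlower.trans_lt hupper).ne (congrArg Subtype.val h)
    simp [hne]
  mem_range := by
    rintro ⟨z, hz₁, hz⟩
    rcases le_or_gt z ω with hzω | hzω
    · refine .inl ⟨⟨z - 1, zero_le, (Ordinal.sub_le_self z 1).trans hzω⟩, Subtype.ext ?_⟩
      change 1 + 1 * (z - 1) = z
      rw [one_mul, Ordinal.add_sub_cancel_of_le hz₁]
    · have hz' : ω + 1 ≤ z := by rwa [add_one_le_iff]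
      refine .inr ⟨⟨z - (ω + 1), zero_le, ?_⟩, Subtype.ext ?_⟩
      · rwa [Ordinal.sub_le, add_one_add_omega0]
      · change ω + 1 + 1 * (z - (ω + 1)) = z
        rw [one_mul, Ordinal.add_sub_cancel_of_le hz']

theorem upperMap_omega0 :
    upperMap ⟨ω, omega0_pos.le, le_rfl⟩ = ⟨ω * 2, one_le_omega0_mul_two, le_rfl⟩ := by
  refine Subtype.ext ?_
  change ω + 1 + 1 * ω = ω * 2
  rw [one_mul, add_one_add_omega0]

theorem isSuccLimit_omega0_mul_two : IsSuccLimit (ω * 2 : Ordinal.{0}) := by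
  rw [Ordinal.mul_two]
  exact isSuccLimit_add ω isSuccLimit_omega0

theorem not_isClosed_compl_omega0_mul_two :
    ¬ IsClosed ({⟨ω * 2, one_le_omega0_mul_two, le_rfl⟩}ᶜ : Set (OrdinalInterval (ω * 2))) :=
  not_isClosed_compl_singleton_ordinalInterval isSuccLimit_omega0_mul_two one_le_omega0_mul_two

theorem nonempty_compl_omega0_mul_two :
    ({⟨ω * 2, one_le_omega0_mul_two, le_rfl⟩}ᶜ : Set (OrdinalInterval (ω * 2))).Nonempty :=
  nonempty_iff_ne_empty.2 fun h => not_isClosed_compl_omega0_mul_two (h ▸ isClosed_empty)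

instance nonempty_ordinalInterval_omega0 : Nonempty (OrdinalInterval ω) :=
  ⟨⟨1, le_rfl, one_lt_omega0.le⟩⟩

/-! ### The two spaces -/

theorem exampleH₁_eq_vanishingOff :
    exampleH₁ = vanishingOff {⟨ω * 2, one_le_omega0_mul_two, le_rfl⟩}ᶜ := by
  ext f
  simp only [mem_vanishingOff, notMem_compl_iff, mem_singleton_iff, forall_eq]
  rfl

theorem exampleH₂_eq_vanishingOff : exampleH₂ = vanishingOff univ :=
  vanishingOff_univ.symm

theorem choquetBoundary_exampleH₁ :
    choquetBoundary exampleH₁ = {⟨ω * 2, one_le_omega0_mul_two, le_rfl⟩}ᶜ := by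
  rw [exampleH₁_eq_vanishingOff,
    choquetBoundary_vanishingOff isOpen_compl_singleton nonempty_compl_omega0_mul_two]

theorem choquetBoundary_exampleH₂ : choquetBoundary exampleH₂ = univ := by
  rw [exampleH₂_eq_vanishingOff, choquetBoundary_vanishingOff isOpen_univ univ_nonempty]

theorem banachMazurDist_example : banachMazurDist exampleH₁ exampleH₂ = 2 := by
  rw [banachMazurDist_congr_right (LinearIsometryEquiv.ofTop _ exampleH₂ rfl),
    exampleH₁_eq_vanishingOff]
  refine le_antisymm ?_
    (two_le_banachMazurDist isOpen_compl_singleton not_isClosed_compl_omega0_mul_two)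
  rw [← upperMap_omega0, ← image_singleton]
  exact isDouble_lowerMap_upperMap.banachMazurDist_le_two isDouble_oddMap_evenMap

theorem rigidityHypotheses_example : RigidityHypotheses exampleH₁ exampleH₂ := by
  have : Countable (OrdinalInterval ω) := countable_ordinalInterval (by simp)
  have : Countable (OrdinalInterval (ω * 2)) := countable_ordinalInterval (by simp)
  have hdist : banachMazurDist exampleH₁ exampleH₂ < 3 := by
    rw [banachMazurDist_example]
    norm_num
  rw [exampleH₁_eq_vanishingOff, exampleH₂_eq_vanishingOff] at hdist ⊢
  exact rigidityHypotheses_vanishingOff isOpen_compl_singleton nonempty_compl_omega0_mul_two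
    (to_countable _) isOpen_univ univ_nonempty (to_countable _) hdist

end OrdinalIntervals

theorem mainTheorem6 :
    -- both Choquet boundaries are countable and consist of weak peak points
    ((choquetBoundary exampleH₁).Countable ∧ (choquetBoundary exampleH₂).Countable ∧
      (∀ x ∈ choquetBoundary exampleH₁, IsWeakPeakPoint exampleH₁ x) ∧
      (∀ x ∈ choquetBoundary exampleH₂, IsWeakPeakPoint exampleH₂ x)) ∧
    -- the Banach-Mazur distance
    banachMazurDist exampleH₁ exampleH₂ = 2 ∧
    -- the pair is a counterexample in which one of the boundaries is not closed
    (RigidityHypotheses exampleH₁ exampleH₂ ∧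
      ¬ IsClosed (choquetBoundary exampleH₁) ∧ IsClosed (choquetBoundary exampleH₂) ∧
      IsEmpty (choquetBoundary exampleH₁ ≃ₜ choquetBoundary exampleH₂)) ∧
    -- so the theorem fails without closedness
    ¬ (∀ (K₁ K₂ : Type 1) (E₁ E₂ : Type)
        [TopologicalSpace K₁] [CompactSpace K₁] [T2Space K₁]
        [TopologicalSpace K₂] [CompactSpace K₂] [T2Space K₂]
        [NormedAddCommGroup E₁] [NormedSpace ℝ E₁] [CompleteSpace E₁]
        [NormedAddCommGroup E₂] [NormedSpace ℝ E₂] [CompleteSpace E₂]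
        (H₁ : Submodule ℝ C(K₁, E₁)) (H₂ : Submodule ℝ C(K₂, E₂)),
        RigidityHypotheses H₁ H₂ →
          Nonempty (choquetBoundary H₁ ≃ₜ choquetBoundary H₂)) := by
  obtain ⟨-, -, -, -, -, -, -, -, -, hcount₁, hcount₂, hpeak₁, hpeak₂, -⟩ :=
    rigidityHypotheses_example
  have hclosed₁ : ¬ IsClosed (choquetBoundary exampleH₁) := by
    rw [choquetBoundary_exampleH₁]
    exact not_isClosed_compl_omega0_mul_two
  have hclosed₂ : IsClosed (choquetBoundary exampleH₂) := by
    rw [choquetBoundary_exampleH₂]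
    exact isClosed_univ
  have : CompactSpace (choquetBoundary exampleH₂) :=
    isCompact_iff_compactSpace.1 hclosed₂.isCompact
  have hempty : IsEmpty (choquetBoundary exampleH₁ ≃ₜ choquetBoundary exampleH₂) :=
    isEmpty_homeomorph_of_not_isClosed hclosed₁
  refine ⟨⟨hcount₁, hcount₂, hpeak₁, hpeak₂⟩, banachMazurDist_example,
    ⟨rigidityHypotheses_example, hclosed₁, hclosed₂, hempty⟩, fun h => ?_⟩
  obtain ⟨e⟩ := h _ _ ℝ ℝ exampleH₁ exampleH₂ rigidityHypotheses_example
  exact hempty.false e
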